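/- Let $N=N_xN_y$ and consider a single-antenna link assisted by a reconfigurable intelligent surface (RIS) with $N$ elements arranged as an $N_x\times N_y$ rectangular planar array, indexed by $n=(n_x,n_y)$, $0\le n_x<N_x$, $0\le n_y<N_y$, with element spacing $\delta>0$ and wavelength $\lambda>0$. For angles $\phi,\varphi\in\mathbb R$ let $\mathbf f(\phi,\varphi)\in\mathbb C^{N}$ have entries $e^{-j2\pi\frac{\delta}{\lambda}(n_x\sin\phi\cos\varphi+n_y\cos\phi)}$. Let $\varrho_t,\varrho_r>0$ (path losses), $\kappa_{\mathbf g},\kappa_{\mathbf h}\ge 0$ (Rician factors) and angles $\phi^A,\varphi^A,\phi^D,\varphi^D$ be given, and let the channel vectors be $$\mathbf g=\sqrt{\tfrac{\kappa_{\mathbf g}}{1+\kappa_{\mathbf g}}}\,\sqrt{\varrho_t}\,\mathbf f(\phi^A,\varphi^A)+\sqrt{\tfrac{1}{1+\kappa_{\mathbf g}}}\,\widetilde{\mathbf g},\qquad \mathbf h^{\mathrm H}=\sqrt{\tfrac{\kappa_{\mathbf h}}{1+\kappa_{\mathbf h}}}\,\sqrt{\varrho_r}\,\mathbf f(\phi^D,\varphi^D)^{\mathrm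 T}+\sqrt{\tfrac{1}{1+\kappa_{\mathbf h}}}\,\widetilde{\mathbf h}^{\mathrm H},$$ where $\widetilde{\mathbf g}\sim\mathcal{CN}(\mathbf 0,\varrho_t\mathbf I)$ and $\widetilde{\mathbf h}\sim\mathcal{CN}(\mathbf 0,\varrho_r\mathbf I)$ are independent circularly symmetric complex Gaussian vectors. Let $\bar{\mathbf\Theta}=\mathrm{diag}(e^{j\theta_1},\dots,e^{j\theta_N})$ be the diagonal phase shift matrix of the co-phased RIS, that is, $\theta_i\in[0,2\pi)$ and $\theta_i\equiv-(\angle[\mathbf h^{\mathrm H}]_i+\angle[\mathbf g]_i)\pmod{2\pi}$. Then, for every realization of the channels, this choice maximizes the channel gain $|\mathbf h^{\mathrm H}\mathrm{diag}(e^{j\theta_1},\dots,e^{j\theta_N})\,\mathbf g|^2$ over all $\theta\in[0,2\pi)^N$. The average gain $\mathfrak g_{\mathrm{diag}}=\mathbb E\big(|\mathbf h^{\mathrm H}\bar{\mathbf\Theta}\mathbf g|^2\big)$ is finite, and $$\mathfrak g_{\mathrm{diag}}=\varrho_t\varrho_r\left(N+\frac{\pi^2}{16}N(N-1)\frac{L_{1/2}^2(-\kappa_{\mathbf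 g})\,L_{1/2}^2(-\kappa_{\mathbf h})}{(\kappa_{\mathbf g}+1)(\kappa_{\mathbf h}+1)}\right),$$ where $L_{1/2}(x)={}_1F_1(-\tfrac12;1;x)=\sum_{n\ge 0}\frac{(-1/2)_n}{(n!)^2}x^n$, with $(a)_n=a(a+1)\cdots(a+n-1)$, is the Laguerre function of degree $\tfrac12$. In particular, for $\kappa_{\mathbf g}=\kappa_{\mathbf h}=0$ (Rayleigh fading), $$\mathfrak g_{\mathrm{diag}}=\varrho_t\varrho_r\left(N+N(N-1)\frac{\pi^2}{16}\right).$$ -/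

import Mathlib

open MeasureTheory ProbabilityTheory

/-- The Laguerre function of (possibly non-integer) degree `ν`,
`L_ν(x) = ₁F₁(-ν; 1; x) = ∑ₙ (-ν)ₙ / (n!)² * xⁿ`, where `(a)ₙ = a (a + 1) ⋯ (a + n - 1)`.
For `ν ∈ ℕ` it is the usual Laguerre polynomial. -/
noncomputable def laguerreL (ν x : ℝ) : ℝ :=
  ∑' n : ℕ, (ascPochhammer ℝ n).eval (-ν) / (n.factorial : ℝ) ^ 2 * x ^ n

/-- The series defining the Laguerre function converges for all arguments. -/
theorem summable_laguerreL (ν x : ℝ) :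
    Summable fun n : ℕ => (ascPochhammer ℝ n).eval (-ν) / (n.factorial : ℝ) ^ 2 * x ^ n := by
  have key : ∀ n : ℕ, |(ascPochhammer ℝ n).eval (-ν)| ≤ (|ν| + 1) ^ n * (n.factorial : ℝ) := by
    intro n
    induction n with
    | zero => simp
    | succ k ih =>
      rw [ascPochhammer_succ_eval, abs_mul, pow_succ, Nat.factorial_succ]
      have h : |(-ν) + (k : ℝ)| ≤ (|ν| + 1) * ((k : ℝ) + 1) := by
        have h1 := abs_add_le (-ν) (k : ℝ)
        rw [abs_neg, Nat.abs_cast] at h1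
        nlinarith [abs_nonneg ν, (Nat.cast_nonneg k : (0 : ℝ) ≤ k),
          mul_nonneg (abs_nonneg ν) (Nat.cast_nonneg k : (0 : ℝ) ≤ k)]
      calc _ ≤ ((|ν| + 1) ^ k * (k.factorial : ℝ)) * ((|ν| + 1) * ((k : ℝ) + 1)) :=
            mul_le_mul ih h (abs_nonneg _) (by positivity)
        _ = _ := by push_cast; ring
  refine Summable.of_norm_bounded (Real.summable_pow_div_factorial ((|ν| + 1) * |x|)) ?_
  intro n
  have hpos : (0 : ℝ) < n.factorial := by exact_mod_cast n.factorial_pos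
  have h1 : |(ascPochhammer ℝ n).eval (-ν)| / (n.factorial : ℝ) ^ 2
      ≤ (|ν| + 1) ^ n / (n.factorial : ℝ) := by
    rw [div_le_div_iff₀ (by positivity) hpos]
    nlinarith [mul_le_mul_of_nonneg_right (key n) hpos.le]
  rw [Real.norm_eq_abs, abs_mul, abs_div, abs_pow, abs_pow, Nat.abs_cast, mul_pow,
    mul_div_right_comm]
  exact mul_le_mul_of_nonneg_right h1 (by positivity)

/-- The circularly symmetric complex Gaussian law `𝒞𝒩(0, v)` of total variance `v ≥ 0`: the real
and imaginary parts are independent real Gaussians of mean `0` and variance `v / 2`. -/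
noncomputable def complexGaussian (v : ℝ) : Measure ℂ :=
  ((gaussianReal 0 (v / 2).toNNReal).prod (gaussianReal 0 (v / 2).toNNReal)).map
    Complex.measurableEquivRealProd.symm

/-- The law `𝒞𝒩(0, v I)` of a random vector with independent `𝒞𝒩(0, v)` entries. -/
noncomputable def complexGaussianVec (ι : Type) [Fintype ι] (v : ℝ) : Measure (ι → ℂ) :=
  Measure.pi fun _ => complexGaussian v

/-- The response of an `Nx × Ny` uniform rectangular planar array with element spacing `δ` at
wavelength `lam`, for elevation angle `φ` and azimuth angle `ϕ`. -/
noncomputable def arrayResponse (Nx Ny : ℕ) (δ lam φ ϕ : ℝ) : Fin Nx × Fin Ny → ℂ := fun n =>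
  Complex.exp (-Complex.I * ((2 * Real.pi * (δ / lam) *
    ((n.1 : ℝ) * Real.sin φ * Real.cos ϕ + (n.2 : ℝ) * Real.cos φ) : ℝ) : ℂ))

/-- Line-of-sight component: an array response scaled by the square root of the path loss. -/
noncomputable def losChannel (Nx Ny : ℕ) (ρ δ lam φ ϕ : ℝ) : Fin Nx × Fin Ny → ℂ := fun n =>
  (Real.sqrt ρ : ℂ) * arrayResponse Nx Ny δ lam φ ϕ n

/-- The Rician channel with Rician factor `κ`, line-of-sight component `los` and
non-line-of-sight component `nlos`. -/
noncomputable def ricianChannel {ι : Type} (κ : ℝ) (los nlos : ι → ℂ) : ι → ℂ := fun n =>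
  (Real.sqrt (κ / (1 + κ)) : ℂ) * los n + (Real.sqrt (1 / (1 + κ)) : ℂ) * nlos n

/-- The diagonal phase shift matrix `diag(e^{jθ₁}, …, e^{jθ_N})`. -/
noncomputable def diagPhaseMatrix {ι : Type} [DecidableEq ι] (θ : ι → ℝ) : Matrix ι ι ℂ :=
  Matrix.diagonal fun n => Complex.exp (Complex.I * (θ n : ℂ))

/-- The channel gain `|hᴴ Θ g|²`; the argument `hH` is the row vector `hᴴ`. -/
noncomputable def channelGain {ι : Type} [Fintype ι] (hH : ι → ℂ) (Θ : Matrix ι ι ℂ)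
    (g : ι → ℂ) : ℝ :=
  ‖hH ⬝ᵥ (Θ.mulVec g)‖ ^ 2

/-- The phase configurations an RIS can realise: each phase shift lies in `[0, 2π)`. -/
def feasiblePhases (ι : Type) : Set (ι → ℝ) :=
  {θ | ∀ n, θ n ∈ Set.Ico 0 (2 * Real.pi)}

/-- The co-phasing configuration `θₙ = -(∠[hᴴ]ₙ + ∠[g]ₙ)`, reduced modulo `2π` to `[0, 2π)`. -/
noncomputable def cophase {ι : Type} (hH g : ι → ℂ) : ι → ℝ := fun n =>
  toIcoMod Real.two_pi_pos 0 (-((hH n).arg + (g n).arg))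

/-- The instantaneous channel gain of the co-phased diagonal RIS. -/
noncomputable def cophasedGain {ι : Type} [Fintype ι] [DecidableEq ι] (hH g : ι → ℂ) : ℝ :=
  channelGain hH (diagPhaseMatrix (cophase hH g)) g

/-! Co-phasing makes every summand of `hᴴ Θ g` equal to `|hₙ||gₙ|`, so the gain is `(∑ |hₙ||gₙ|)²`,
the bound that the triangle inequality gives for any phases. Expanding the square, independence
yields `N` diagonal terms `E|h|² E|g|² = ρr ρt` and `N(N-1)` off-diagonal terms `(E|h|)² (E|g|)²`.

The substance is the Rician mean `integral_norm_add_smul_complexGaussian`. Write `exp(-|z-a|²)` as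
`exp(-|z|²-|a|²)` times the double power series of `exp(ā z) exp(a z̄)`. Rotation invariance kills
all terms but `(ā z)ⁿ(a z̄)ⁿ`, whose integrals are Gamma values. The result is `exp(-|a|²)
L_{-3/2}(|a|²)` up to a constant, and Kummer's transformation makes it `L_{1/2}(-|a|²)`. Each mean
carries a factor `√π/2`, whence `π²/16`. -/

/-! ### Laguerre functions and Kummer's transformation -/

theorem ascPochhammer_eval_eq_factorial_mul_multichoose (a : ℝ) (n : ℕ) :
    (ascPochhammer ℝ n).eval a = (n.factorial : ℝ) * Ring.multichoose a n := by
  have h := Ring.factorial_nsmul_multichoose_eq_ascPochhammer a n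
  rw [Polynomial.ascPochhammer_smeval_eq_eval, nsmul_eq_mul] at h
  exact h.symm

/-- Chu–Vandermonde with upper entries `n` and `-a`; it compares the coefficients in Kummer's
transformation. -/
theorem sum_antidiagonal_choose_mul_multichoose (a : ℝ) (n : ℕ) :
    ∑ p ∈ Finset.HasAntidiagonal.antidiagonal n,
      (n.choose p.1 : ℝ) * ((-1) ^ p.1 * Ring.multichoose a p.2) =
      (-1) ^ n * Ring.multichoose (1 - a) n := by
  have hneg : ∀ j : ℕ, Ring.multichoose a j = (-1) ^ j * Ring.choose (-a) j := by
    intro j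
    rw [Ring.choose_neg', Ring.multichoose_eq, Int.negOnePow_def, Units.smul_def, zsmul_eq_mul,
      ← mul_assoc]
    simp [← mul_pow]
  have h := Ring.add_choose_eq n (Commute.all (n : ℝ) (-a))
  rw [Ring.multichoose_eq, show 1 - a + (n : ℝ) - 1 = n + -a by ring, h, Finset.mul_sum]
  refine Finset.sum_congr rfl fun p hp => ?_
  rw [hneg, Ring.choose_natCast, ← Finset.HasAntidiagonal.mem_antidiagonal.1 hp, pow_add]
  ring

/-- Kummer's transformation, for the Laguerre functions. -/
theorem laguerreL_neg (ν x : ℝ) :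
    laguerreL ν (-x) = Real.exp (-x) * laguerreL (-(ν + 1)) x := by
  have hexp : Real.exp (-x) = ∑' n : ℕ, (-x) ^ n / (n.factorial : ℝ) := by
    rw [Real.exp_eq_exp_ℝ, NormedSpace.exp_eq_tsum_div]
  rw [hexp, laguerreL, laguerreL, tsum_mul_tsum_eq_tsum_sum_antidiagonal_of_summable_norm
    (Real.summable_pow_div_factorial (-x)).norm (summable_laguerreL _ _).norm]
  refine tsum_congr fun n => ?_
  have h := sum_antidiagonal_choose_mul_multichoose (ν + 1) n
  have hn : (n.factorial : ℝ) ≠ 0 := by exact_mod_cast n.factorial_ne_zero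
  rw [ascPochhammer_eval_eq_factorial_mul_multichoose, show -ν = 1 - (ν + 1) by ring,
    show ∀ m : ℝ, n.factorial * m / (n.factorial : ℝ) ^ 2 * (-x) ^ n
      = ((-1) ^ n * m) * (x ^ n / n.factorial) by intro m; rw [neg_pow]; field_simp, ← h,
    Finset.sum_mul]
  refine Finset.sum_congr rfl fun p hp => ?_
  obtain rfl := Finset.HasAntidiagonal.mem_antidiagonal.1 hp
  have h1 : (p.1.factorial : ℝ) ≠ 0 := by exact_mod_cast p.1.factorial_ne_zero
  have h2 : (p.2.factorial : ℝ) ≠ 0 := by exact_mod_cast p.2.factorial_ne_zero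
  rw [ascPochhammer_eval_eq_factorial_mul_multichoose, neg_neg, Nat.cast_add_choose, neg_pow x,
    pow_add]
  field_simp

/-- Turns the radial integrals into the coefficients of `laguerreL (-3/2)`. -/
theorem Gamma_natCast_add_three_halves (n : ℕ) :
    Real.Gamma (n + 3 / 2) = √Real.pi / 2 * (ascPochhammer ℝ n).eval (3 / 2) := by
  induction n with
  | zero =>
    rw [Nat.cast_zero, zero_add, show (3 / 2 : ℝ) = 1 / 2 + 1 by norm_num,
      Real.Gamma_add_one (by norm_num), Real.Gamma_one_half_eq]
    simp
    ring
  | succ n ih =>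
    rw [ascPochhammer_succ_eval, ← mul_assoc, ← ih, Nat.cast_succ, add_right_comm,
      Real.Gamma_add_one (by positivity)]
    ring

theorem laguerreL_one_half_zero : laguerreL (1 / 2) 0 = 1 := by
  rw [laguerreL, tsum_eq_single 0 (fun n hn => by simp [hn])]
  simp

/-! ### Gaussian integrals over the complex plane -/

open scoped ComplexConjugate

theorem Complex.integrable_norm_pow_mul_exp_neg_mul_sq (k : ℕ) {b : ℝ} (hb : 0 < b) :
    Integrable fun z : ℂ => ‖z‖ ^ k * Real.exp (-b * ‖z‖ ^ 2) := by
  -- A non-integrable function has integral `0` by convention, so a positive value proves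
  -- integrability.
  refine not_imp_comm.1 integral_undef (ne_of_gt ?_)
  have h := Complex.integral_rpow_mul_exp_neg_mul_rpow (p := 2) (q := k) (b := b)
    (by norm_num) (by linarith [(Nat.cast_nonneg k : (0 : ℝ) ≤ k)]) hb
  simp only [Real.rpow_natCast, Real.rpow_two] at h
  rw [h]
  have := Real.pi_pos
  have := Real.Gamma_pos_of_pos (s := ((k : ℝ) + 2) / 2) (by positivity)
  positivity

theorem Complex.integral_norm_pow_mul_exp_neg_sq (k : ℕ) :
    ∫ z : ℂ, ‖z‖ ^ k * Real.exp (-‖z‖ ^ 2) = Real.pi * Real.Gamma ((k + 2) / 2) := by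
  have h := Complex.integral_rpow_mul_exp_neg_rpow (p := 2) (q := k)
    (by norm_num) (by linarith [(Nat.cast_nonneg k : (0 : ℝ) ≤ k)])
  simp only [Real.rpow_natCast, Real.rpow_two] at h
  rw [h]
  ring

/-- Monomials of nonzero weight under rotations integrate to zero against radial functions. -/
theorem Complex.integral_radial_mul_pow_mul_conj_pow_of_ne (w : ℝ → ℂ) {j k : ℕ} (hjk : j ≠ k) :
    ∫ z : ℂ, w ‖z‖ * (z ^ j * conj z ^ k) = 0 := by
  -- Rotation by `t` multiplies `z ^ j * conj z ^ k` by `exp(i(j-k)t) = -1`, so the integral equals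
  -- its own negative.
  set t : ℝ := Real.pi / ((j : ℝ) - k)
  have hd : ((j : ℝ) - k) ≠ 0 := sub_ne_zero.2 (by exact_mod_cast hjk)
  have hu : (Circle.exp t : ℂ) ^ j * conj (Circle.exp t : ℂ) ^ k = -1 := by
    rw [Circle.coe_exp, ← Complex.exp_conj, ← Complex.exp_nat_mul, ← Complex.exp_nat_mul,
      ← Complex.exp_add, ← Complex.exp_pi_mul_I]
    congr 1
    rw [map_mul, Complex.conj_ofReal, Complex.conj_I]
    have : ((j : ℂ) - k) * t = Real.pi := by
      rw [← Complex.ofReal_natCast, ← Complex.ofReal_natCast, ← Complex.ofReal_sub,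
        ← Complex.ofReal_mul, mul_div_cancel₀ _ hd]
    rw [← this]
    ring
  have h := (rotation (Circle.exp t)).measurePreserving.integral_comp
    (rotation (Circle.exp t)).toHomeomorph.measurableEmbedding
    (fun z : ℂ => w ‖z‖ * (z ^ j * conj z ^ k))
  have h2 : ∀ z : ℂ, w ‖rotation (Circle.exp t) z‖ *
      (rotation (Circle.exp t) z ^ j * conj (rotation (Circle.exp t) z) ^ k) =
      - (w ‖z‖ * (z ^ j * conj z ^ k)) := by
    intro z
    rw [LinearIsometryEquiv.norm_map, rotation_apply, map_mul, mul_pow, mul_pow]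
    linear_combination (w ‖z‖ * (z ^ j * conj z ^ k)) * hu
  simp only [h2] at h
  rw [integral_neg] at h
  exact self_eq_neg.1 h.symm

theorem Complex.hasSum_exp (z : ℂ) : HasSum (fun n : ℕ => z ^ n / n.factorial) (Complex.exp z) := by
  rw [Complex.exp_eq_exp_ℂ]
  exact NormedSpace.expSeries_div_hasSum_exp z

theorem Real.hasSum_exp' (x : ℝ) : HasSum (fun n : ℕ => x ^ n / n.factorial) (Real.exp x) := by
  rw [Real.exp_eq_exp_ℝ]
  exact NormedSpace.expSeries_div_hasSum_exp x

theorem HasSum.mul_of_rclike {R : Type*} [RCLike R] {f g : ℕ → R} {a b : R} (hf : HasSum f a)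
    (hg : HasSum g b) : HasSum (fun p : ℕ × ℕ => f p.1 * g p.2) (a * b) :=
  hf.mul hg (summable_mul_of_summable_norm hf.summable.norm hg.summable.norm)

theorem hasSum_pow_div_factorial_mul {R : Type*} [RCLike R] {z w a b : R}
    (hz : HasSum (fun n : ℕ => z ^ n / n.factorial) a)
    (hw : HasSum (fun n : ℕ => w ^ n / n.factorial) b) :
    HasSum (fun p : ℕ × ℕ => z ^ p.1 / p.1.factorial * (w ^ p.2 / p.2.factorial)) (a * b) := by
  have h := hz.mul_of_rclike hw
  exact h

theorem Complex.hasSum_exp_mul_exp (z w : ℂ) :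
    HasSum (fun p : ℕ × ℕ => z ^ p.1 / p.1.factorial * (w ^ p.2 / p.2.factorial))
      (Complex.exp z * Complex.exp w) :=
  hasSum_pow_div_factorial_mul (Complex.hasSum_exp z) (Complex.hasSum_exp w)

theorem Real.hasSum_exp_mul_exp (z w : ℝ) :
    HasSum (fun p : ℕ × ℕ => z ^ p.1 / p.1.factorial * (w ^ p.2 / p.2.factorial))
      (Real.exp z * Real.exp w) :=
  hasSum_pow_div_factorial_mul (Real.hasSum_exp' z) (Real.hasSum_exp' w)

theorem Complex.integrable_norm_mul_exp_neg_sq_mul_exp (c : ℝ) :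
    Integrable fun z : ℂ =>
      ‖z‖ * Real.exp (-‖z‖ ^ 2) * (Real.exp (c * ‖z‖) * Real.exp (c * ‖z‖)) := by
  refine ((Complex.integrable_norm_pow_mul_exp_neg_mul_sq 1 (b := 1 / 2) (by norm_num)).mul_const
    (Real.exp (2 * c ^ 2))).mono' (by fun_prop) (.of_forall fun z => ?_)
  rw [Real.norm_of_nonneg (by positivity), pow_one, mul_assoc, mul_assoc, ← Real.exp_add,
    ← Real.exp_add, ← Real.exp_add]
  refine mul_le_mul_of_nonneg_left (Real.exp_le_exp.2 ?_) (norm_nonneg z)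
  -- `-r² + 2cr ≤ -r²/2 + 2c²`, by completing the square.
  nlinarith [sq_nonneg (‖z‖ - 2 * c)]

/-- The first absolute moment of a shifted standard complex Gaussian density, as a series. -/
theorem Complex.hasSum_integral_norm_mul_exp_neg_norm_sub_sq (a : ℂ) :
    HasSum (fun n : ℕ => Real.exp (-‖a‖ ^ 2) * (Real.pi *
      (Real.Gamma (n + 3 / 2) / (n.factorial : ℝ) ^ 2 * (‖a‖ ^ 2) ^ n)))
      (∫ z : ℂ, ‖z‖ * Real.exp (-‖z - a‖ ^ 2)) := by
  set w : ℝ → ℂ := fun r => ((r * Real.exp (-r ^ 2) : ℝ) : ℂ)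
  have hw : ∀ z : ℂ, ‖w ‖z‖‖ = ‖z‖ * Real.exp (-‖z‖ ^ 2) := fun z => by
    rw [Complex.norm_real, Real.norm_of_nonneg (by positivity)]
  have hwc : Continuous w := by fun_prop
  set F : ℕ × ℕ → ℂ → ℂ := fun p z =>
    w ‖z‖ * ((conj a * z) ^ p.1 / p.1.factorial * ((a * conj z) ^ p.2 / p.2.factorial))
  -- The termwise norms sum to `‖z‖ exp(-‖z‖²) exp(2‖a‖‖z‖)`, which is integrable.
  have hS := hasSum_integral_of_dominated_convergence (μ := (volume : Measure ℂ)) (F := F)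
    (f := fun z => w ‖z‖ * (Complex.exp (conj a * z) * Complex.exp (a * conj z)))
    (fun p z => ‖z‖ * Real.exp (-‖z‖ ^ 2) * ((‖a‖ * ‖z‖) ^ p.1 / p.1.factorial *
      ((‖a‖ * ‖z‖) ^ p.2 / p.2.factorial)))
    (fun p => by
      refine Continuous.aestronglyMeasurable ?_
      have := Complex.continuous_conj
      fun_prop)
    (fun p => .of_forall fun z => by
      simp only [F, norm_mul, norm_div, norm_pow, hw, RCLike.norm_conj, Complex.norm_natCast]
      exact le_rfl)
    (.of_forall fun z => ((Real.hasSum_exp_mul_exp _ _).mul_left _).summable)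
    (by
      simp_rw [((Real.hasSum_exp_mul_exp _ _).mul_left _).tsum_eq]
      exact Complex.integrable_norm_mul_exp_neg_sq_mul_exp ‖a‖)
    (.of_forall fun z => (Complex.hasSum_exp_mul_exp _ _).mul_left _)
  have hF : ∀ p, F p = fun z => (conj a ^ p.1 * a ^ p.2 / (p.1.factorial * p.2.factorial)) *
      (w ‖z‖ * (z ^ p.1 * conj z ^ p.2)) := by
    intro p; ext z
    simp only [F, mul_pow]
    ring
  have hdiag : ∀ n : ℕ, ∫ z, F (n, n) z = ((Real.pi *
      (Real.Gamma (n + 3 / 2) / (n.factorial : ℝ) ^ 2 * (‖a‖ ^ 2) ^ n) : ℝ) : ℂ) := by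
    intro n
    have h1 : ∀ z : ℂ, w ‖z‖ * (z ^ n * conj z ^ n) =
        ((‖z‖ ^ (2 * n + 1) * Real.exp (-‖z‖ ^ 2) : ℝ) : ℂ) := by
      intro z
      rw [← mul_pow, Complex.mul_conj, Complex.normSq_eq_norm_sq]
      simp only [w]
      push_cast
      ring
    rw [hF, integral_const_mul]
    simp only [h1]
    rw [integral_complex_ofReal, Complex.integral_norm_pow_mul_exp_neg_sq, ← mul_pow,
      mul_comm (conj a), Complex.mul_conj, Complex.normSq_eq_norm_sq,
      show (((2 * n + 1 : ℕ) : ℝ) + 2) / 2 = n + 3 / 2 by push_cast; ring]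
    push_cast
    ring
  have hinj : Function.Injective fun n : ℕ => (n, n) := fun m n h => (Prod.ext_iff.1 h).1
  -- Only the pairs `(n, n)` contribute, so the double series collapses to a single one.
  have hS2 := (hinj.hasSum_iff (f := fun p => ∫ z, F p z) fun p hp => by
    have hne : p.1 ≠ p.2 := fun h => hp ⟨p.1, Prod.ext rfl h⟩
    rw [hF, integral_const_mul, Complex.integral_radial_mul_pow_mul_conj_pow_of_ne w hne,
      mul_zero]).2 hS
  have hS3 := hS2.mul_left ((Real.exp (-‖a‖ ^ 2) : ℝ) : ℂ)
  rw [← integral_const_mul] at hS3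
  have hf : ∀ z : ℂ, ((Real.exp (-‖a‖ ^ 2) : ℝ) : ℂ) *
      (w ‖z‖ * (Complex.exp (conj a * z) * Complex.exp (a * conj z))) =
      ((‖z‖ * Real.exp (-‖z - a‖ ^ 2) : ℝ) : ℂ) := by
    intro z
    have h1 : ((‖z - a‖ ^ 2 : ℝ) : ℂ) =
        ((‖z‖ ^ 2 : ℝ) : ℂ) + ((‖a‖ ^ 2 : ℝ) : ℂ) - conj a * z - a * conj z := by
      simp only [← Complex.normSq_eq_norm_sq, ← Complex.mul_conj, map_sub]
      ring
    simp only [w]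
    rw [Complex.ofReal_mul, Complex.ofReal_mul, Complex.ofReal_exp, Complex.ofReal_exp,
      Complex.ofReal_exp, Complex.ofReal_neg, Complex.ofReal_neg, Complex.ofReal_neg, h1,
      mul_left_comm, mul_assoc, ← Complex.exp_add, ← Complex.exp_add, ← Complex.exp_add]
    ring_nf
  simp only [hf, Function.comp_def, hdiag, ← Complex.ofReal_mul] at hS3
  rw [integral_complex_ofReal] at hS3
  exact_mod_cast hS3

/-! ### Moments of complex Gaussian and Rician variables -/

theorem integral_complexGaussian {E : Type*} [NormedAddCommGroup E] [NormedSpace ℝ E] {v : ℝ}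
    (hv : 0 < v) (f : ℂ → E) :
    ∫ z, f z ∂complexGaussian v =
      ∫ w : ℂ, (Real.pi⁻¹ * Real.exp (-‖w‖ ^ 2)) • f ((√v : ℝ) • w) := by
  have hv2 : (v / 2).toNNReal ≠ 0 := by simpa using hv
  have hm : Measurable (gaussianPDF 0 (v / 2).toNNReal) := measurable_gaussianPDF _ _
  have hs : 0 < √v := Real.sqrt_pos.2 hv
  rw [complexGaussian, integral_map_equiv, gaussianReal_of_var_ne_zero _ hv2,
    prod_withDensity hm hm, integral_withDensity_eq_integral_toReal_smul (by fun_prop)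
      (.of_forall fun p => ENNReal.mul_lt_top gaussianPDF_lt_top gaussianPDF_lt_top),
    ← Measure.volume_eq_prod, ← Complex.volume_preserving_equiv_real_prod.integral_comp
      Complex.measurableEquivRealProd.measurableEmbedding]
  -- Scaling the plane by `√v` has Jacobian `(√v)² = v`, which absorbs the variance in the density.
  have h := Measure.integral_comp_smul_of_nonneg (volume : Measure ℂ) (fun z : ℂ =>
    (Real.pi⁻¹ * Real.exp (-‖(√v)⁻¹ • z‖ ^ 2)) • f z) (√v) (hR := hs.le)
  simp only [inv_smul_smul₀ hs.ne'] at h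
  rw [h, Complex.finrank_real_complex, Real.sq_sqrt hv.le, ← integral_smul]
  refine integral_congr_ae (.of_forall fun z => ?_)
  simp only [smul_smul, ENNReal.toReal_mul,
    toReal_gaussianPDF, gaussianPDFReal, norm_smul, Complex.measurableEquivRealProd_apply,
    Real.coe_toNNReal _ (half_pos hv).le]
  congr 1
  rw [mul_mul_mul_comm, ← Real.exp_add, ← mul_inv, ← pow_two √(2 * Real.pi * (v / 2)),
    Real.sq_sqrt (by positivity), ← mul_assoc, mul_pow, ← Complex.normSq_eq_norm_sq,
    Complex.normSq_apply, norm_inv, inv_pow, Real.norm_of_nonneg hs.le, Real.sq_sqrt hv.le]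
  congr 2
  · field_simp
  · field_simp
    ring

instance isProbabilityMeasure_complexGaussian (v : ℝ) :
    IsProbabilityMeasure (complexGaussian v) :=
  Measure.isProbabilityMeasure_map (by fun_prop)

theorem memLp_id_complexGaussian (v : ℝ) : MemLp (fun z : ℂ => z) 2 (complexGaussian v) := by
  rw [complexGaussian, memLp_map_measure_iff (by fun_prop) (by fun_prop), ← memLp_re_im_iff]
  have h := memLp_id_gaussianReal' (μ := 0) (v := (v / 2).toNNReal) 2 (by simp)
  exact ⟨h.comp_measurePreserving measurePreserving_fst,
    h.comp_measurePreserving measurePreserving_snd⟩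

theorem integral_id_complexGaussian {v : ℝ} (hv : 0 < v) :
    ∫ z, z ∂complexGaussian v = 0 := by
  rw [integral_complexGaussian hv]
  have h := Complex.integral_radial_mul_pow_mul_conj_pow_of_ne
    (fun r => ((Real.pi⁻¹ * Real.exp (-r ^ 2) * √v : ℝ) : ℂ)) one_ne_zero
  simpa [smul_smul, mul_assoc] using h

theorem integral_norm_sq_complexGaussian {v : ℝ} (hv : 0 < v) :
    ∫ z, ‖z‖ ^ 2 ∂complexGaussian v = v := by
  rw [integral_complexGaussian hv]
  have h := Complex.integral_norm_pow_mul_exp_neg_sq 2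
  have h1 : ∀ w : ℂ, (Real.pi⁻¹ * Real.exp (-‖w‖ ^ 2)) • ‖√v • w‖ ^ 2 =
      (Real.pi⁻¹ * v) * (‖w‖ ^ 2 * Real.exp (-‖w‖ ^ 2)) := by
    intro w
    rw [norm_smul, mul_pow, Real.norm_of_nonneg (Real.sqrt_nonneg v), Real.sq_sqrt hv.le,
      smul_eq_mul]
    ring
  have h2 : ((2 : ℕ) + 2 : ℝ) / 2 = 2 := by norm_num
  simp only [h1]
  rw [integral_const_mul, h, h2, Real.Gamma_two]
  have := Real.pi_ne_zero
  field_simp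

theorem memLp_norm_add_smul_complexGaussian (v d : ℝ) (m : ℂ) :
    MemLp (fun z : ℂ => ‖m + d • z‖) 2 (complexGaussian v) :=
  ((memLp_const m).add ((memLp_id_complexGaussian v).const_smul d)).norm

/-- The cross term vanishes because the Gaussian is centred. -/
theorem integral_norm_add_smul_sq_complexGaussian {v : ℝ} (hv : 0 < v) (d : ℝ) (m : ℂ) :
    ∫ z, ‖m + d • z‖ ^ 2 ∂complexGaussian v = ‖m‖ ^ 2 + d ^ 2 * v := by
  have hi := (memLp_id_complexGaussian v).integrable (by norm_num)
  have hi2 := (memLp_id_complexGaussian v).integrable_norm_pow (by norm_num)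
  have h1 : ∀ z : ℂ, ‖m + d • z‖ ^ 2 = ‖m‖ ^ 2 + 2 * d * inner ℝ m z + d ^ 2 * ‖z‖ ^ 2 := by
    intro z
    rw [norm_add_sq_real, inner_smul_right, norm_smul, mul_pow, Real.norm_eq_abs, sq_abs]
    ring
  have hin : Integrable (fun z : ℂ => 2 * d * inner ℝ m z) (complexGaussian v) :=
    (hi.const_inner m).const_mul _
  have hin2 : Integrable (fun z : ℂ => ‖m‖ ^ 2 + 2 * d * inner ℝ m z) (complexGaussian v) :=
    (integrable_const _).add hin
  simp only [h1]
  rw [integral_add hin2 (hi2.const_mul _),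
    integral_add (integrable_const _) hin, integral_const_mul, integral_const_mul,
    integral_inner hi, integral_id_complexGaussian hv, integral_norm_sq_complexGaussian hv]
  simp

/-- The mean of a Rician random variable. -/
theorem integral_norm_add_smul_complexGaussian {v d : ℝ} (hv : 0 < v) (hd : 0 < d) (m : ℂ) :
    ∫ z, ‖m + d • z‖ ∂complexGaussian v =
      √Real.pi / 2 * (d * √v) * laguerreL (1 / 2) (-(‖m‖ ^ 2 / (d ^ 2 * v))) := by
  have hs : 0 < d * √v := mul_pos hd (Real.sqrt_pos.2 hv)
  -- The mean in units of the scale: `m + d√v w = d√v (w + a)`, so translating by `a` reduces to the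
  -- shifted density.
  set a : ℂ := (d * √v)⁻¹ • m
  have ha : ‖a‖ ^ 2 = ‖m‖ ^ 2 / (d ^ 2 * v) := by
    rw [norm_smul, norm_inv, Real.norm_of_nonneg hs.le, mul_pow, inv_pow, mul_pow,
      Real.sq_sqrt hv.le]
    ring
  have h1 : ∀ w : ℂ, (Real.pi⁻¹ * Real.exp (-‖w‖ ^ 2)) • ‖m + d • √v • w‖ =
      (Real.pi⁻¹ * (d * √v)) * (‖w + a‖ * Real.exp (-‖w + a - a‖ ^ 2)) := by
    intro w
    have : m + d • √v • w = (d * √v) • (w + a) := by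
      rw [smul_add, smul_inv_smul₀ hs.ne', smul_smul, add_comm]
    rw [this, norm_smul, Real.norm_of_nonneg hs.le, add_sub_cancel_right, smul_eq_mul]
    ring
  have h2 := (Complex.hasSum_integral_norm_mul_exp_neg_norm_sub_sq a).tsum_eq
  rw [tsum_mul_left, tsum_mul_left] at h2
  have h3 : ∀ n : ℕ, Real.Gamma (n + 3 / 2) / (n.factorial : ℝ) ^ 2 * (‖a‖ ^ 2) ^ n =
      √Real.pi / 2 * ((ascPochhammer ℝ n).eval (-(-(1 / 2 + 1))) / (n.factorial : ℝ) ^ 2 *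
        (‖a‖ ^ 2) ^ n) := by
    intro n
    rw [Gamma_natCast_add_three_halves, neg_neg, show (1 / 2 + 1 : ℝ) = 3 / 2 by norm_num]
    ring
  rw [integral_complexGaussian hv]
  simp only [h1]
  rw [integral_const_mul, integral_add_right_eq_self
    (fun z : ℂ => ‖z‖ * Real.exp (-‖z - a‖ ^ 2)) a, ← h2, tsum_congr h3, tsum_mul_left, ← ha,
    laguerreL_neg, ← laguerreL]
  have := Real.pi_ne_zero
  field_simp

/-! ### Optimality of co-phasing -/

theorem Matrix.dotProduct_diagPhaseMatrix_mulVec {ι : Type} [Fintype ι] [DecidableEq ι]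
    (hH g : ι → ℂ) (θ : ι → ℝ) :
    hH ⬝ᵥ ((diagPhaseMatrix θ).mulVec g) =
      ∑ n, hH n * (Complex.exp (Complex.I * (θ n : ℂ)) * g n) := by
  simp [dotProduct, diagPhaseMatrix, Matrix.mulVec_diagonal]

theorem mul_exp_cophase_mul {ι : Type} (hH g : ι → ℂ) (n : ι) :
    hH n * (Complex.exp (Complex.I * (cophase hH g n : ℂ)) * g n) =
      ((‖hH n‖ * ‖g n‖ : ℝ) : ℂ) := by
  have hexp : Complex.exp (Complex.I * (cophase hH g n : ℂ)) =
      Complex.exp (-((hH n).arg * Complex.I + (g n).arg * Complex.I)) := by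
    refine Complex.exp_eq_exp_iff_exists_int.2
      -- The number of full turns removed by the reduction modulo `2π`, with opposite sign.
      ⟨-toIcoDiv Real.two_pi_pos 0 (-((hH n).arg + (g n).arg)), ?_⟩
    rw [cophase, ← self_sub_toIcoDiv_zsmul]
    push_cast [zsmul_eq_mul]
    ring
  have h1 := Complex.exp_ne_zero ((hH n).arg * Complex.I)
  have h2 := Complex.exp_ne_zero ((g n).arg * Complex.I)
  rw [hexp, Complex.exp_neg, Complex.exp_add]
  calc _ = (‖hH n‖ * Complex.exp ((hH n).arg * Complex.I)) *
        ((Complex.exp ((hH n).arg * Complex.I) * Complex.exp ((g n).arg * Complex.I))⁻¹ *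
          (‖g n‖ * Complex.exp ((g n).arg * Complex.I))) := by
        rw [Complex.norm_mul_exp_arg_mul_I, Complex.norm_mul_exp_arg_mul_I]
    _ = _ := by
        generalize Complex.exp ((hH n).arg * Complex.I) = u at *
        generalize Complex.exp ((g n).arg * Complex.I) = v at *
        push_cast
        field_simp

theorem cophasedGain_eq {ι : Type} [Fintype ι] [DecidableEq ι] (hH g : ι → ℂ) :
    cophasedGain hH g = (∑ n, ‖hH n‖ * ‖g n‖) ^ 2 := by
  rw [cophasedGain, channelGain, Matrix.dotProduct_diagPhaseMatrix_mulVec,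
    Finset.sum_congr rfl fun n _ => mul_exp_cophase_mul hH g n, ← Complex.ofReal_sum,
    Complex.norm_real, Real.norm_eq_abs, sq_abs]

theorem channelGain_diagPhaseMatrix_le_cophasedGain {ι : Type} [Fintype ι] [DecidableEq ι]
    (hH g : ι → ℂ) (θ : ι → ℝ) :
    channelGain hH (diagPhaseMatrix θ) g ≤ cophasedGain hH g := by
  rw [cophasedGain_eq, channelGain, Matrix.dotProduct_diagPhaseMatrix_mulVec]
  refine pow_le_pow_left₀ (norm_nonneg _) ((norm_sum_le _ _).trans_eq ?_) 2
  refine Finset.sum_congr rfl fun n _ => ?_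
  rw [norm_mul, norm_mul, mul_comm Complex.I, Complex.norm_exp_ofReal_mul_I, one_mul]

theorem cophase_mem_feasiblePhases {ι : Type} (hH g : ι → ℂ) :
    cophase hH g ∈ feasiblePhases ι := fun n => by
  simpa [cophase] using toIcoMod_mem_Ico Real.two_pi_pos 0 (-((hH n).arg + (g n).arg))

/-! ### Second moments of sums of independent products -/

/-- Distinct coordinates are independent. The functions `f n` may vary with `n`, as line-of-sight
phases do; only their first two moments must agree. -/
theorem integral_pi_eval_mul_eval {ι E : Type*} [Fintype ι] [DecidableEq ι] [MeasurableSpace E]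
    {μ : Measure E} [IsProbabilityMeasure μ] {f : ι → E → ℝ} (hf : ∀ n, Measurable (f n))
    {A₁ A₂ : ℝ} (h₁ : ∀ n, ∫ x, f n x ∂μ = A₁) (h₂ : ∀ n, ∫ x, f n x ^ 2 ∂μ = A₂) (n m : ι) :
    ∫ x : ι → E, f n (x n) * f m (x m) ∂(Measure.pi fun _ => μ) =
      if n = m then A₂ else A₁ ^ 2 := by
  have hev : ∀ (k : ι) {F : E → ℝ}, Measurable F →
      ∫ x : ι → E, F (x k) ∂(Measure.pi fun _ => μ) = ∫ y, F y ∂μ := fun k F hF =>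
    (measurePreserving_eval (fun _ : ι => μ) k).hasLaw.integral_comp hF.aestronglyMeasurable
  split_ifs with hnm
  · subst hnm
    simp only [← pow_two]
    rw [hev n ((hf n).pow_const 2), h₂]
  · have hind := (iIndepFun_pi (μ := fun _ : ι => μ) (X := f)
      fun i => (hf i).aemeasurable).indepFun hnm
    have h := hind.integral_fun_mul_eq_mul_integral
      ((hf n).comp (measurable_pi_apply n)).aestronglyMeasurable
      ((hf m).comp (measurable_pi_apply m)).aestronglyMeasurable
    rw [h, hev n (hf n), hev m (hf m), h₁, h₁, pow_two]

theorem memLp_eval_comp_of_hasLaw_pi {Ω ι E : Type*} [MeasurableSpace Ω] {P : Measure Ω}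
    [Fintype ι] [MeasurableSpace E] {μ : Measure E} [IsProbabilityMeasure μ]
    {X : Ω → ι → E} (hX : HasLaw X (Measure.pi fun _ => μ) P) {f : E → ℝ} (hf : MemLp f 2 μ)
    (n : ι) : MemLp (fun ω => f (X ω n)) 2 P := by
  have h := hf.comp_measurePreserving (measurePreserving_eval (fun _ : ι => μ) n)
  rw [← hX.map_eq] at h
  exact h.comp_of_map hX.aemeasurable

/-- Second moment of a sum of products of independent amplitudes. -/
theorem integrable_and_integral_sum_mul_sq {Ω ι E F : Type*} [MeasurableSpace Ω] {P : Measure Ω}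
    [IsProbabilityMeasure P] [Fintype ι] [DecidableEq ι] [MeasurableSpace E] [MeasurableSpace F]
    {μ : Measure E} {ν : Measure F} [IsProbabilityMeasure μ] [IsProbabilityMeasure ν]
    {X : Ω → ι → E} {Y : Ω → ι → F} (hX : HasLaw X (Measure.pi fun _ => μ) P)
    (hY : HasLaw Y (Measure.pi fun _ => ν) P) (hXY : IndepFun X Y P)
    {a : ι → E → ℝ} {b : ι → F → ℝ} (ha : ∀ n, Measurable (a n)) (hb : ∀ n, Measurable (b n))
    (ha2 : ∀ n, MemLp (a n) 2 μ) (hb2 : ∀ n, MemLp (b n) 2 ν) {A₁ A₂ B₁ B₂ : ℝ}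
    (hA₁ : ∀ n, ∫ x, a n x ∂μ = A₁) (hA₂ : ∀ n, ∫ x, a n x ^ 2 ∂μ = A₂)
    (hB₁ : ∀ n, ∫ x, b n x ∂ν = B₁) (hB₂ : ∀ n, ∫ x, b n x ^ 2 ∂ν = B₂) :
    Integrable (fun ω => (∑ n, b n (Y ω n) * a n (X ω n)) ^ 2) P ∧
      ∫ ω, (∑ n, b n (Y ω n) * a n (X ω n)) ^ 2 ∂P =
        Fintype.card ι * (A₂ * B₂) +
          Fintype.card ι * (Fintype.card ι - 1) * (A₁ ^ 2 * B₁ ^ 2) := by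
  set U : ι → ι → (ι → E) → ℝ := fun n m x => a n (x n) * a m (x m)
  set V : ι → ι → (ι → F) → ℝ := fun n m y => b n (y n) * b m (y m)
  have hU : ∀ n m, Measurable (U n m) := fun n m =>
    ((ha n).comp (measurable_pi_apply n)).mul ((ha m).comp (measurable_pi_apply m))
  have hV : ∀ n m, Measurable (V n m) := fun n m =>
    ((hb n).comp (measurable_pi_apply n)).mul ((hb m).comp (measurable_pi_apply m))
  have hind : ∀ n m, IndepFun (fun ω => U n m (X ω)) (fun ω => V n m (Y ω)) P := fun n m =>
    hXY.comp (hU n m) (hV n m)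
  have hUi : ∀ n m, Integrable (fun ω => U n m (X ω)) P := fun n m =>
    (memLp_eval_comp_of_hasLaw_pi hX (ha2 n) n).integrable_mul
      (memLp_eval_comp_of_hasLaw_pi hX (ha2 m) m)
  have hVi : ∀ n m, Integrable (fun ω => V n m (Y ω)) P := fun n m =>
    (memLp_eval_comp_of_hasLaw_pi hY (hb2 n) n).integrable_mul
      (memLp_eval_comp_of_hasLaw_pi hY (hb2 m) m)
  have hUVi : ∀ n m, Integrable (fun ω => U n m (X ω) * V n m (Y ω)) P := fun n m =>
    (hind n m).integrable_mul (hUi n m) (hVi n m)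
  -- A constant plus a diagonal correction, so that the double sum is immediate.
  have hUV : ∀ n m, ∫ ω, U n m (X ω) * V n m (Y ω) ∂P =
      A₁ ^ 2 * B₁ ^ 2 + if n = m then A₂ * B₂ - A₁ ^ 2 * B₁ ^ 2 else 0 := by
    intro n m
    have hx : ∫ ω, U n m (X ω) ∂P = if n = m then A₂ else A₁ ^ 2 :=
      (hX.integral_comp (hU n m).aestronglyMeasurable).trans
        (integral_pi_eval_mul_eval ha hA₁ hA₂ n m)
    have hy : ∫ ω, V n m (Y ω) ∂P = if n = m then B₂ else B₁ ^ 2 :=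
      (hY.integral_comp (hV n m).aestronglyMeasurable).trans
        (integral_pi_eval_mul_eval hb hB₁ hB₂ n m)
    rw [(hind n m).integral_fun_mul_eq_mul_integral (hUi n m).aestronglyMeasurable
      (hVi n m).aestronglyMeasurable, hx, hy]
    split_ifs <;> ring
  have hsq : ∀ ω, (∑ n, b n (Y ω n) * a n (X ω n)) ^ 2 =
      ∑ n, ∑ m, U n m (X ω) * V n m (Y ω) := by
    intro ω
    rw [pow_two, Finset.sum_mul_sum]
    refine Finset.sum_congr rfl fun n _ => Finset.sum_congr rfl fun m _ => ?_
    simp only [U, V]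
    ring
  simp only [hsq]
  refine ⟨integrable_finsetSum _ fun n _ => integrable_finsetSum _ fun m _ => hUVi n m, ?_⟩
  rw [integral_finsetSum _ fun n _ => integrable_finsetSum _ fun m _ => hUVi n m]
  simp only [integral_finsetSum _ fun m _ => hUVi _ m, hUV, Finset.sum_add_distrib,
    Finset.sum_ite_eq, Finset.mem_univ, if_true, Finset.sum_const, Finset.card_univ, nsmul_eq_mul]
  ring

/-! ### Rician channels and the average gain -/

theorem norm_arrayResponse (Nx Ny : ℕ) (δ lam φ ϕ : ℝ) (n : Fin Nx × Fin Ny) :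
    ‖arrayResponse Nx Ny δ lam φ ϕ n‖ = 1 := by
  rw [arrayResponse, Complex.norm_exp, Complex.re_mul_ofReal]
  simp

theorem norm_losChannel (Nx Ny : ℕ) (ρ δ lam φ ϕ : ℝ) (n : Fin Nx × Fin Ny) :
    ‖losChannel Nx Ny ρ δ lam φ ϕ n‖ = √ρ := by
  rw [losChannel, norm_mul, norm_arrayResponse, mul_one, Complex.norm_real,
    Real.norm_of_nonneg (Real.sqrt_nonneg ρ)]

theorem integral_norm_rician_sq {ρ κ : ℝ} (hρ : 0 < ρ) (hκ : 0 ≤ κ) {m : ℂ}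
    (hm : ‖m‖ = √(κ / (1 + κ)) * √ρ) :
    ∫ z, ‖m + √(1 / (1 + κ)) • z‖ ^ 2 ∂complexGaussian ρ = ρ := by
  rw [integral_norm_add_smul_sq_complexGaussian hρ, hm, mul_pow, Real.sq_sqrt (by positivity),
    Real.sq_sqrt hρ.le, Real.sq_sqrt (by positivity)]
  field_simp
  ring

/-- The ratio of line-of-sight to scattered power is exactly `κ`. -/
theorem integral_norm_rician {ρ κ : ℝ} (hρ : 0 < ρ) (hκ : 0 ≤ κ) {m : ℂ}
    (hm : ‖m‖ = √(κ / (1 + κ)) * √ρ) :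
    ∫ z, ‖m + √(1 / (1 + κ)) • z‖ ∂complexGaussian ρ =
      √Real.pi / 2 * (√(1 / (1 + κ)) * √ρ) * laguerreL (1 / 2) (-κ) := by
  rw [integral_norm_add_smul_complexGaussian hρ (Real.sqrt_pos.2 (by positivity)), hm, mul_pow,
    Real.sq_sqrt (by positivity), Real.sq_sqrt hρ.le, Real.sq_sqrt (by positivity)]
  congr 3
  field_simp

theorem mainTheorem3
    {Ω : Type*} [MeasurableSpace Ω] (P : Measure Ω) [IsProbabilityMeasure P]
    (Nx Ny : ℕ)
    -- path losses, Rician factors, element spacing, wavelength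
    (ρt ρr κg κh δ lam : ℝ)
    (hρt : 0 < ρt) (hρr : 0 < ρr) (hκg : 0 ≤ κg) (hκh : 0 ≤ κh) (hδ : 0 < δ) (hlam : 0 < lam)
    -- angles of arrival and of departure at the RIS
    (φA ϕA φD ϕD : ℝ)
    -- non-line-of-sight components
    (gNLoS hNLoS : Ω → Fin Nx × Fin Ny → ℂ)
    (hgNLoS : HasLaw gNLoS (complexGaussianVec (Fin Nx × Fin Ny) ρt) P)
    (hhNLoS : HasLaw hNLoS (complexGaussianVec (Fin Nx × Fin Ny) ρr) P)
    (hindep : IndepFun gNLoS hNLoS P)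
    -- the channel `g` and the row vector `hᴴ`
    (g hH : Ω → Fin Nx × Fin Ny → ℂ)
    (hg : ∀ ω, g ω = ricianChannel κg (losChannel Nx Ny ρt δ lam φA ϕA) (gNLoS ω))
    (hh : ∀ ω, hH ω = ricianChannel κh (losChannel Nx Ny ρr δ lam φD ϕD) (star (hNLoS ω)))
    (N : ℕ) (hN : N = Nx * Ny) :
    -- co-phasing is feasible and maximizes the gain over all diagonal phase shift matrices
    (∀ ω, cophase (hH ω) (g ω) ∈ feasiblePhases (Fin Nx × Fin Ny) ∧
      ∀ θ ∈ feasiblePhases (Fin Nx × Fin Ny),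
        channelGain (hH ω) (diagPhaseMatrix θ) (g ω) ≤ cophasedGain (hH ω) (g ω)) ∧
    -- the average gain exists and equals the closed form
    Integrable (fun ω => cophasedGain (hH ω) (g ω)) P ∧
    ∫ ω, cophasedGain (hH ω) (g ω) ∂P =
      ρt * ρr * ((N : ℝ) + Real.pi ^ 2 / 16 * (N : ℝ) * ((N : ℝ) - 1) *
        (laguerreL (1 / 2) (-κg) ^ 2 * laguerreL (1 / 2) (-κh) ^ 2 /
          ((κg + 1) * (κh + 1)))) ∧
    -- Rayleigh fading
    (κg = 0 → κh = 0 →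
      ∫ ω, cophasedGain (hH ω) (g ω) ∂P =
        ρt * ρr * ((N : ℝ) + (N : ℝ) * ((N : ℝ) - 1) * (Real.pi ^ 2 / 16))) := by
  set mg : Fin Nx × Fin Ny → ℂ := fun n =>
    (√(κg / (1 + κg)) : ℂ) * losChannel Nx Ny ρt δ lam φA ϕA n
  -- Conjugating the line-of-sight part instead of `hNLoS` leaves the modulus of `hH` unchanged and
  -- lets the law of `hNLoS` be used directly.
  set mh : Fin Nx × Fin Ny → ℂ := fun n =>
    star ((√(κh / (1 + κh)) : ℂ) * losChannel Nx Ny ρr δ lam φD ϕD n)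
  have hmg : ∀ n, ‖mg n‖ = √(κg / (1 + κg)) * √ρt := fun n => by
    rw [norm_mul, norm_losChannel, Complex.norm_real, Real.norm_of_nonneg (Real.sqrt_nonneg _)]
  have hmh : ∀ n, ‖mh n‖ = √(κh / (1 + κh)) * √ρr := fun n => by
    rw [norm_star, norm_mul, norm_losChannel, Complex.norm_real,
      Real.norm_of_nonneg (Real.sqrt_nonneg _)]
  have hga : ∀ ω n, ‖g ω n‖ = ‖mg n + √(1 / (1 + κg)) • gNLoS ω n‖ := fun ω n => by
    rw [hg, ricianChannel, Complex.real_smul]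
  have hha : ∀ ω n, ‖hH ω n‖ = ‖mh n + √(1 / (1 + κh)) • hNLoS ω n‖ := fun ω n => by
    rw [hh, ricianChannel, ← norm_star, star_add, star_mul', Pi.star_apply, Complex.real_smul]
    simp [mh]
  obtain ⟨hint, hval⟩ := integrable_and_integral_sum_mul_sq hgNLoS hhNLoS hindep
    (a := fun n z => ‖mg n + √(1 / (1 + κg)) • z‖) (b := fun n z => ‖mh n + √(1 / (1 + κh)) • z‖)
    (fun n => by fun_prop) (fun n => by fun_prop)
    (fun n => memLp_norm_add_smul_complexGaussian _ _ _)
    (fun n => memLp_norm_add_smul_complexGaussian _ _ _)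
    (fun n => integral_norm_rician hρt hκg (hmg n))
    (fun n => integral_norm_rician_sq hρt hκg (hmg n))
    (fun n => integral_norm_rician hρr hκh (hmh n))
    (fun n => integral_norm_rician_sq hρr hκh (hmh n))
  have hgain : ∀ ω, cophasedGain (hH ω) (g ω) = (∑ n, ‖mh n + √(1 / (1 + κh)) • hNLoS ω n‖ *
      ‖mg n + √(1 / (1 + κg)) • gNLoS ω n‖) ^ 2 := fun ω => by
    simp only [cophasedGain_eq, hga, hha]
  have hmean : ∫ ω, cophasedGain (hH ω) (g ω) ∂P =
      ρt * ρr * ((N : ℝ) + Real.pi ^ 2 / 16 * (N : ℝ) * ((N : ℝ) - 1) *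
        (laguerreL (1 / 2) (-κg) ^ 2 * laguerreL (1 / 2) (-κh) ^ 2 /
          ((κg + 1) * (κh + 1)))) := by
    simp only [hgain]
    rw [hval, Fintype.card_prod, Fintype.card_fin, Fintype.card_fin, ← hN]
    simp only [mul_pow, div_pow]
    rw [Real.sq_sqrt Real.pi_pos.le, Real.sq_sqrt hρt.le, Real.sq_sqrt hρr.le,
      Real.sq_sqrt (by positivity), Real.sq_sqrt (by positivity), add_comm 1 κg, add_comm 1 κh]
    field_simp
    ring
  refine ⟨fun ω => ⟨cophase_mem_feasiblePhases _ _, fun θ _ =>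
    channelGain_diagPhaseMatrix_le_cophasedGain _ _ θ⟩, ?_, hmean, ?_⟩
  · simpa only [hgain] using hint
  · rintro rfl rfl
    rw [hmean, neg_zero, laguerreL_one_half_zero]
    ring
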